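/- Fix $\epsilon\in[0,1]$ and consider the binary erasure channel with input alphabet $\{0,1\}$, output alphabet $\{0,1,?\}$ and erasure probability $\epsilon$: the erasure indicators $\theta_1,\theta_2,\dots$ are i.i.d. with $\Pr(\theta_i=1)=\epsilon$, independent of the message, and the output at time $i$ is $y_i=\,?$ if $\theta_i=1$ and $y_i=x_i$ if $\theta_i=0$. The transmitted sequence $x_1x_2\cdots x_n$ must satisfy the $(1,\infty)$-RLL constraint, i.e. it must not contain two consecutive ones. A message $M$ is drawn uniformly from $\{1,\dots,\lceil 2^{nR}\rceil\}$. In the feedback setting, a code of block length $n$ consists of encoding functions $x_i=f_i(m,y^{i-1})\in\{0,1\}$, $i=1,\dots,n$, depending on the message and the previous outputs $y^{i-1}=(y_1,\dots,y_{i-1})$, that satisfy the input constraint, together with a decoding function $\Psi$ from $\{0,1,?\}^n$ to the set of messages. In the non-causal setting, everything is the same except that the encoder also knows, before choosing $x_i$, whether this symbol will be erased: $x_i=f_i(m,y^{i-1},\theta_i)$. In either setting, a rate $R\ge 0$ is achievable if there is a sequence of codes, one for each block length $n$, whose average probability of error $\Pr(M\neq\Psi(Y^n))$ tends to $0$ as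 $n\to\infty$. Let $C^{\mathrm{fb}}_\epsilon$ and $C^{\mathrm{nc}}_\epsilon$ be the suprema of the achievable rates in the feedback and in the non-causal setting, respectively. Then non-causal knowledge of the erasures does not increase the feedback capacity: $$C^{\mathrm{nc}}_\epsilon=C^{\mathrm{fb}}_\epsilon .$$ -/

import Mathlib

noncomputable section

namespace RLLErasure

/-- The channel output alphabet `{0, 1, ?}`: `some x` is the received bit `x`, `none` is `?`.
The input alphabet `{0, 1}` is `Bool`, with `true` for `1`. -/
abbrev Output : Type := Option Bool

/-- The transition probabilities `p(y | x)` of the binary erasure channel. -/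
def erasureChannel (ε : ℝ) (x : Bool) (y : Output) : ℝ :=
  if y = none then ε else if y = some x then 1 - ε else 0

/-- The law of an erasure indicator: `P(θ = 1) = ε`, `P(θ = 0) = 1 - ε`. -/
def erasureLaw (ε : ℝ) (θ : Bool) : ℝ :=
  if θ = true then ε else 1 - ε

/-- The symbol received when `x` is sent and the erasure indicator is `θ`. -/
def received (x θ : Bool) : Output :=
  if θ = true then none else some x

/-- The entries of `y` strictly before time `i`. -/
def past {n : ℕ} {α : Type} (y : Fin n → α) (i : Fin n) : Fin (i : ℕ) → α :=
  fun j => y (Fin.castLE i.isLt.le j)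

/-- A code of block length `n` with `M` messages for the `(1,∞)`-RLL input-constrained channel
with feedback. -/
structure FeedbackCode (n M : ℕ) where
  /-- The input at time `i`, given the message and the previous outputs. -/
  enc : (i : Fin n) → Fin M → (Fin (i : ℕ) → Output) → Bool
  /-- The decoding function. -/
  dec : (Fin n → Output) → Fin M
  /-- No two consecutive ones. -/
  rll : ∀ (m : Fin M) (y : Fin n → Output) (i j : Fin n), (i : ℕ) + 1 = (j : ℕ) →
    enc i m (past y i) = true → enc j m (past y j) = false

/-- A code of block length `n` with `M` messages for the `(1,∞)`-RLL input-constrained erasure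
channel whose encoder is told, before it chooses the input at time `i`, whether that input is
going to be erased. -/
structure NoncausalCode (n M : ℕ) where
  /-- The input at time `i`, given the message, the previous outputs and the indicator `θ i`
  of an erasure at time `i`. The earlier indicators can be read off the previous outputs. -/
  enc : (i : Fin n) → Fin M → (Fin (i : ℕ) → Output) → Bool → Bool
  /-- The decoding function. -/
  dec : (Fin n → Output) → Fin M
  /-- No two consecutive ones. The indicator that the encoder saw at time `i` is the one that
  the output `y i` displays; the indicator `θ` at time `j = i + 1` is arbitrary. -/
  rll : ∀ (m : Fin M) (y : Fin n → Output) (i j : Fin n) (θ : Bool), (i : ℕ) + 1 = (j : ℕ) →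
    enc i m (past y i) (y i).isNone = true → enc j m (past y j) θ = false

/-- The probability that the output is `y`, given that the message is `m`: at each time the
channel acts on the current input independently of the past. -/
def FeedbackCode.outputProb {n M : ℕ} (c : FeedbackCode n M) (ε : ℝ) (m : Fin M)
    (y : Fin n → Output) : ℝ :=
  ∏ i, erasureChannel ε (c.enc i m (past y i)) (y i)

/-- The average probability of error `P(M ≠ Ψ(Y^n))`, for a uniformly distributed message. -/
def FeedbackCode.errorProb {n M : ℕ} (c : FeedbackCode n M) (ε : ℝ) : ℝ :=
  (∑ m : Fin M, ∑ y : Fin n → Output,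
    if c.dec y ≠ m then c.outputProb ε m y else 0) / (M : ℝ)

/-- The probability that the erasure pattern is `θ` and the output is `y`, given that the message
is `m`: the erasure indicators are i.i.d. and independent of the message, and the output at each
time is determined by the current input and indicator. -/
def NoncausalCode.jointProb {n M : ℕ} (c : NoncausalCode n M) (ε : ℝ) (m : Fin M)
    (θ : Fin n → Bool) (y : Fin n → Output) : ℝ :=
  ∏ i, erasureLaw ε (θ i) *
    (if y i = received (c.enc i m (past y i) (θ i)) (θ i) then 1 else 0)

/-- The average probability of error `P(M ≠ Ψ(Y^n))`, for a uniformly distributed message. -/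
def NoncausalCode.errorProb {n M : ℕ} (c : NoncausalCode n M) (ε : ℝ) : ℝ :=
  (∑ m : Fin M, ∑ θ : Fin n → Bool, ∑ y : Fin n → Output,
    if c.dec y ≠ m then c.jointProb ε m θ y else 0) / (M : ℝ)

/-- The number of messages `2^{nR}`, rounded up to an integer. -/
def numMessages (R : ℝ) (n : ℕ) : ℕ := ⌈(2 : ℝ) ^ ((n : ℝ) * R)⌉₊

/-- `R` is a `(1,∞)`-achievable rate in the feedback setting. -/
def FeedbackAchievable (ε R : ℝ) : Prop :=
  0 ≤ R ∧ ∃ c : (n : ℕ) → FeedbackCode n (numMessages R n),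
    Filter.Tendsto (fun n => (c n).errorProb ε) Filter.atTop (nhds 0)

/-- `R` is a `(1,∞)`-achievable rate in the non-causal setting. -/
def NoncausalAchievable (ε R : ℝ) : Prop :=
  0 ≤ R ∧ ∃ c : (n : ℕ) → NoncausalCode n (numMessages R n),
    Filter.Tendsto (fun n => (c n).errorProb ε) Filter.atTop (nhds 0)

/-- The feedback capacity: the supremum of the achievable rates, in the extended reals. -/
def feedbackCapacity (ε : ℝ) : EReal :=
  sSup {C : EReal | ∃ R : ℝ, FeedbackAchievable ε R ∧ C = (R : EReal)}

/-- The non-causal capacity: the supremum of the achievable rates, in the extended reals. -/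
def noncausalCapacity (ε : ℝ) : EReal :=
  sSup {C : EReal | ∃ R : ℝ, NoncausalAchievable ε R ∧ C = (R : EReal)}

end RLLErasure

end

/-! Both capacities equal `C / log 2`, where `p = (1 - p) ^ (2 - ε)`, `a = -log (1 - p)` and `C = (1
- ε) * a`. The outputs drive a nested sequence of intervals: in an unblocked slot a received `1`
keeps a fraction `p`, a received `0` a fraction `1 - p`, and an erasure keeps everything. A received
`1` blocks the next slot, which yields no information. For this `p` a received `0` gains `a` nats
and a received `1` gains `a + C`; the excess `C` exactly pays for the blocked slot. Hence the
potential drifts by `C` per step whichever bits are sent (`Cell.potential_step_some`), and by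
Chebyshev the width is about `exp (-n * C)` for every strategy that sends `0` after a received `1`.

Non-causal encoders are such strategies, since an input that is erased is invisible
(`NoncausalCode.admissible`). Comparing their output law with the reference law `patternProb *
width` (`sum_patternProb_mul_width`) bounds the rate by `C` nats. Conversely, a feedback encoder
knows the interval and can steer it towards a point representing the message. Exchanging the ends
after an erasure keeps the input legal because `p ≤ 1 / 2`. -/

noncomputable section

namespace RLLErasure

open Filter Topology

/-! ### The law of the output under a feedback strategy -/

/-- The probability of the output `y` when the inputs are chosen by the strategy `e`. -/
def pathProb (ε : ℝ) (e : (k : ℕ) → (Fin k → Output) → Bool) (n : ℕ) (y : Fin n → Output) : ℝ :=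
  ∏ i : Fin n, erasureChannel ε (e i (past y i)) (y i)

lemma past_snoc_castSucc {n : ℕ} (z : Fin n → Output) (b : Output) (i : Fin n) :
    past (Fin.snoc z b : Fin (n + 1) → Output) i.castSucc = past z i := by
  funext j
  exact Fin.snoc_castSucc (α := fun _ => Output) b z (Fin.castLE i.isLt.le j)

lemma past_snoc_last {n : ℕ} (z : Fin n → Output) (b : Output) :
    past (Fin.snoc z b : Fin (n + 1) → Output) (Fin.last n) = z := by
  funext j
  exact Fin.snoc_castSucc (α := fun _ => Output) b z j

lemma pathProb_snoc (ε : ℝ) (e : (k : ℕ) → (Fin k → Output) → Bool) (n : ℕ)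
    (z : Fin n → Output) (b : Output) :
    pathProb ε e (n + 1) (Fin.snoc z b) = pathProb ε e n z * erasureChannel ε (e n z) b := by
  unfold pathProb
  rw [Fin.prod_univ_castSucc]
  congr 1
  · refine Finset.prod_congr rfl fun i _ => ?_
    rw [past_snoc_castSucc, Fin.snoc_castSucc]
    rfl
  · rw [past_snoc_last, Fin.snoc_last]
    rfl

lemma erasureChannel_nonneg {ε : ℝ} (h0 : 0 ≤ ε) (h1 : ε ≤ 1) (x : Bool) (y : Output) :
    0 ≤ erasureChannel ε x y := by
  unfold erasureChannel
  split_ifs <;> linarith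

lemma pathProb_nonneg {ε : ℝ} (h0 : 0 ≤ ε) (h1 : ε ≤ 1)
    (e : (k : ℕ) → (Fin k → Output) → Bool) (n : ℕ) (y : Fin n → Output) :
    0 ≤ pathProb ε e n y :=
  Finset.prod_nonneg fun _ _ => erasureChannel_nonneg h0 h1 _ _

lemma sum_output (f : Output → ℝ) : ∑ b, f b = f none + f (some true) + f (some false) := by
  rw [Fintype.sum_option, Fintype.sum_bool, add_assoc]

lemma sum_snoc (n : ℕ) (f : (Fin (n + 1) → Output) → ℝ) :
    ∑ y, f y = ∑ z : Fin n → Output, ∑ b, f (Fin.snoc z b) := by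
  rw [Finset.sum_comm, ← Fintype.sum_prod_type',
    ← (Fin.snocEquiv (fun _ : Fin (n + 1) => Output)).sum_comp]
  rfl

/-- One step of the chain of outputs: an erasure has probability `ε`, and otherwise the input
chosen by the strategy is received. -/
lemma sum_pathProb_succ (ε : ℝ) (e : (k : ℕ) → (Fin k → Output) → Bool) (n : ℕ)
    (f : (Fin (n + 1) → Output) → ℝ) :
    ∑ y, pathProb ε e (n + 1) y * f y =
      ∑ z : Fin n → Output, pathProb ε e n z *
        (ε * f (Fin.snoc z none) + (1 - ε) * f (Fin.snoc z (some (e n z)))) := by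
  rw [sum_snoc]
  refine Finset.sum_congr rfl fun z _ => ?_
  simp only [pathProb_snoc, sum_output]
  cases h : e n z <;> simp [erasureChannel] <;> ring

lemma sum_pathProb (ε : ℝ) (e : (k : ℕ) → (Fin k → Output) → Bool) (n : ℕ) :
    ∑ y, pathProb ε e n y = 1 := by
  induction n with
  | zero => simp [pathProb]
  | succ n ih =>
    have h := sum_pathProb_succ ε e n (fun _ => 1)
    simp only [mul_one, add_sub_cancel] at h
    rw [h, ih]

/-- A property of output strings that survives every transition of positive probability holds
for all output strings of positive probability. -/
lemma pathProb_induction {ε : ℝ} {e : (k : ℕ) → (Fin k → Output) → Bool}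
    {motive : (n : ℕ) → (Fin n → Output) → Prop} (h0 : ∀ y, motive 0 y)
    (hnone : ∀ n z, pathProb ε e n z ≠ 0 → motive n z → motive (n + 1) (Fin.snoc z none))
    (hsome : ∀ n z, pathProb ε e n z ≠ 0 → motive n z →
      motive (n + 1) (Fin.snoc z (some (e n z)))) :
    ∀ n y, pathProb ε e n y ≠ 0 → motive n y := by
  intro n
  induction n with
  | zero => exact fun y _ => h0 y
  | succ n ih =>
    intro y hy
    induction y using Fin.snocCases with
    | snoc z b =>
      rw [pathProb_snoc] at hy
      have hz := left_ne_zero_of_mul hy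
      have hb := right_ne_zero_of_mul hy
      match b, hb with
      | none, _ => exact hnone n z hz (ih z hz)
      | some x, hb =>
        have hx : x = e n z := by
          by_contra hne
          simp [erasureChannel, hne] at hb
        exact hx ▸ hsome n z hz (ih z hz)

/-! ### Interval splitting -/

/-- Whether the input `1` is assigned to the lower end of the current interval, to its upper end,
or is forbidden. -/
inductive Mode
  | low
  | high
  | blocked
  deriving DecidableEq

/-- An interval `[lo, lo + width)`, with the mode of its next subdivision. -/
structure Cell where
  /-- The left end point. -/
  lo : ℝ
  /-- The length. -/
  width : ℝ
  /-- The mode of the next subdivision. -/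
  mode : Mode

/-- The new interval after an output: a received bit selects the part of the interval that was
assigned to it, and an erasure exchanges the two ends. -/
def Cell.step (p : ℝ) : Cell → Output → Cell
  | ⟨a, w, .low⟩, none => ⟨a, w, .high⟩
  | ⟨a, w, .high⟩, none => ⟨a, w, .low⟩
  | ⟨a, w, .blocked⟩, none => ⟨a, w, .low⟩
  | ⟨a, w, .low⟩, some false => ⟨a + p * w, (1 - p) * w, .low⟩
  | ⟨a, w, .high⟩, some false => ⟨a, (1 - p) * w, .low⟩
  | ⟨a, w, .blocked⟩, some false => ⟨a, w, .low⟩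
  | ⟨a, w, .low⟩, some true => ⟨a, p * w, .blocked⟩
  | ⟨a, w, .high⟩, some true => ⟨a + (1 - p) * w, p * w, .blocked⟩
  -- Width `0` for this forbidden output keeps `Cell.sum_step_width` an identity.
  | ⟨a, _, .blocked⟩, some true => ⟨a, 0, .low⟩

/-- The part of the interval that is assigned to the input `1`. -/
def Cell.ones (p : ℝ) : Cell → Set ℝ
  | ⟨a, w, .low⟩ => Set.Ico a (a + p * w)
  | ⟨a, w, .high⟩ => Set.Ico (a + (1 - p) * w) (a + w)
  | ⟨_, _, .blocked⟩ => ∅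

/-- The interval after the outputs `y`. -/
def cell (p : ℝ) : (n : ℕ) → (Fin n → Output) → Cell
  | 0, _ => ⟨0, 1, .low⟩
  | n + 1, y => (cell p n (Fin.init y)).step p (y (Fin.last n))

lemma cell_snoc (p : ℝ) (n : ℕ) (z : Fin n → Output) (b : Output) :
    cell p (n + 1) (Fin.snoc z b) = (cell p n z).step p b := by
  simp [cell]

lemma Cell.step_width_nonneg {p : ℝ} (hp0 : 0 ≤ p) (hp1 : p ≤ 1) (s : Cell) (hs : 0 ≤ s.width)
    (b : Output) : 0 ≤ (s.step p b).width := by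
  have h1 : 0 ≤ 1 - p := by linarith
  obtain ⟨a, w, m⟩ := s
  have hw : 0 ≤ w := hs
  rcases b with _ | _ | _ <;> cases m <;> simp only [Cell.step] <;> positivity

lemma cell_width_nonneg {p : ℝ} (hp0 : 0 ≤ p) (hp1 : p ≤ 1) (n : ℕ) (y : Fin n → Output) :
    0 ≤ (cell p n y).width := by
  induction n with
  | zero => simp [cell]
  | succ n ih => exact Cell.step_width_nonneg hp0 hp1 _ (ih _) _

/-- Subdivision respects the `(1,∞)`-RLL constraint. -/
lemma Cell.notMem_ones_step {p : ℝ} (hp : p ≤ 1 / 2) (s : Cell) (hs : 0 ≤ s.width)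
    (b : Output) (x : ℝ) (hx : x ∈ s.ones p) : x ∉ (s.step p b).ones p := by
  obtain ⟨a, w, m⟩ := s
  have hw : 0 ≤ w := hs
  -- `h1` separates the two ends after an erasure; `h2` handles a received `0` in mode `high`.
  have h1 : 0 ≤ (1 - 2 * p) * w := mul_nonneg (by linarith) hw
  have h2 : 0 ≤ (1 - p) * ((1 - p) * w) :=
    mul_nonneg (by linarith) (mul_nonneg (by linarith) hw)
  rcases b with _ | _ | _ <;> cases m <;> simp only [Cell.step, Cell.ones, Set.mem_Ico,
    Set.mem_empty_iff_false, not_and, not_lt, not_false_eq_true] at hx ⊢ <;>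
    (intro h; nlinarith)

open Classical in
/-- The interval that is selected by the bit assigned to a point contains the point. -/
lemma Cell.mem_step {p : ℝ} (s : Cell) (x : ℝ) (hx : x ∈ Set.Ico s.lo (s.lo + s.width)) :
    x ∈ Set.Ico (s.step p (some (decide (x ∈ s.ones p)))).lo
      ((s.step p (some (decide (x ∈ s.ones p)))).lo +
        (s.step p (some (decide (x ∈ s.ones p)))).width) := by
  obtain ⟨a, w, m⟩ := s
  obtain ⟨h1, h2⟩ := hx
  dsimp only at h1 h2
  by_cases h : x ∈ Cell.ones p ⟨a, w, m⟩ <;> simp only [h, decide_true, decide_false] <;>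
    cases m <;> simp only [Cell.step, Cell.ones, Set.mem_Ico, not_and, not_lt,
      Set.mem_empty_iff_false, not_false_eq_true] at h ⊢
  · exact h
  · exact ⟨h.1, by linarith [h.2]⟩
  · exact ⟨h h1, by linarith⟩
  · refine ⟨h1, ?_⟩
    by_contra hc
    linarith [h (not_lt.mp hc)]
  · exact ⟨h1, h2⟩

lemma Cell.mem_step_none {p : ℝ} (s : Cell) (x : ℝ) (hx : x ∈ Set.Ico s.lo (s.lo + s.width)) :
    x ∈ Set.Ico (s.step p none).lo ((s.step p none).lo + (s.step p none).width) := by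
  obtain ⟨a, w, m⟩ := s
  cases m <;> exact hx

/-- The conditional mean of the width when each bit is received according to the subdivision. -/
lemma Cell.sum_step_width (p ε : ℝ) (s : Cell) :
    ε * (s.step p none).width + (1 - ε) * (s.step p (some true)).width
      + (1 - ε) * (s.step p (some false)).width = s.width := by
  obtain ⟨a, w, m⟩ := s
  cases m <;> simp only [Cell.step] <;> ring

/-- The probability of the erasure pattern that is visible in the output `y`. -/
def patternProb (ε : ℝ) {n : ℕ} (y : Fin n → Output) : ℝ :=
  ∏ i, if y i = none then ε else 1 - ε

lemma patternProb_nonneg {ε : ℝ} (h0 : 0 ≤ ε) (h1 : ε ≤ 1) {n : ℕ} (y : Fin n → Output) :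
    0 ≤ patternProb ε y :=
  Finset.prod_nonneg fun _ _ => by split_ifs <;> linarith

/-- Given the message, the erasure pattern is the only randomness in the output. -/
lemma pathProb_le_patternProb {ε : ℝ} (h0 : 0 ≤ ε) (h1 : ε ≤ 1)
    (e : (k : ℕ) → (Fin k → Output) → Bool) (n : ℕ) (y : Fin n → Output) :
    pathProb ε e n y ≤ patternProb ε y := by
  refine Finset.prod_le_prod (fun _ _ => erasureChannel_nonneg h0 h1 _ _) fun i _ => ?_
  unfold erasureChannel
  split_ifs <;> linarith

/-- The summand is a probability law on outputs that does not depend on the code: the reference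
measure of the converse. -/
lemma sum_patternProb_mul_width (p ε : ℝ) (n : ℕ) :
    ∑ y : Fin n → Output, patternProb ε y * (cell p n y).width = 1 := by
  induction n with
  | zero => simp [patternProb, cell]
  | succ n ih =>
    rw [sum_snoc, ← ih]
    refine Finset.sum_congr rfl fun z _ => ?_
    have hs : ∀ b, patternProb ε (Fin.snoc z b : Fin (n + 1) → Output) =
        patternProb ε z * if b = none then ε else 1 - ε := by
      intro b
      simp [patternProb, Fin.prod_univ_castSucc]
    rw [sum_output]
    simp only [hs, cell_snoc]
    rw [← Cell.sum_step_width p ε (cell p n z)]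
    simp
    ring

/-! ### Concentration of the width -/

/-- A strategy that sends `0` whenever the current cell is blocked. -/
def Admissible (ε p : ℝ) (e : (k : ℕ) → (Fin k → Output) → Bool) : Prop :=
  ∀ k z, pathProb ε e k z ≠ 0 → (cell p k z).mode = .blocked → e k z = false

/-- Only a `1` received in a blocked cell collapses the interval, and admissibility excludes it. -/
lemma cell_width_pos {ε p : ℝ} (hp0 : 0 < p) (hp1 : p < 1)
    {e : (k : ℕ) → (Fin k → Output) → Bool} (he : Admissible ε p e) (n : ℕ) (y : Fin n → Output)
    (hy : pathProb ε e n y ≠ 0) : 0 < (cell p n y).width := by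
  have h1 : 0 < 1 - p := by linarith
  refine pathProb_induction (motive := fun n y => 0 < (cell p n y).width) ?_ ?_ ?_ n y hy
  · simp [cell]
  · intro n z hz hw
    rw [cell_snoc]
    rcases hc : cell p n z with ⟨a, w, m⟩
    rw [hc] at hw
    cases m <;> exact hw
  · intro n z hz hw
    have ha := he n z hz
    rw [cell_snoc]
    rcases hc : cell p n z with ⟨a, w, m⟩
    rw [hc] at hw ha
    have hw : 0 < w := hw
    cases m
    · cases e n z <;> simp only [Cell.step] <;> positivity
    · cases e n z <;> simp only [Cell.step] <;> positivity
    · rw [ha rfl]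
      exact hw

/-- The information gained so far, corrected by the loss of time caused by a blocked cell. -/
def Cell.potential (C : ℝ) (s : Cell) : ℝ :=
  -Real.log s.width - if s.mode = .blocked then C else 0

lemma Cell.potential_step_none (p C : ℝ) (s : Cell) :
    (s.step p none).potential C = s.potential C + if s.mode = .blocked then C else 0 := by
  obtain ⟨a, w, m⟩ := s
  cases m <;> simp [Cell.step, Cell.potential]

/-- A received `1` gains `a + C` but enters a blocked cell, charged `C`; so both bits gain `a`, and
the drift does not depend on the strategy. -/
lemma Cell.potential_step_some {p a C : ℝ} (hp0 : 0 < p) (hp1 : p < 1)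
    (ha : Real.log (1 - p) = -a) (hC : Real.log p = -(a + C)) (s : Cell) (hs : 0 < s.width)
    (x : Bool) (hx : s.mode = .blocked → x = false) :
    (s.step p (some x)).potential C =
      s.potential C + if s.mode = .blocked then C else a := by
  obtain ⟨l, w, m⟩ := s
  have hw : w ≠ 0 := ne_of_gt hs
  have h1 : 1 - p ≠ 0 := by linarith
  cases m <;> cases x <;> simp_all [Cell.step, Cell.potential, Real.log_mul, hp0.ne'] <;> ring

/-- The second moment of the fluctuation of the potential grows at most linearly. -/
lemma sum_pathProb_mul_sq_le {ε p a C : ℝ} (h0 : 0 ≤ ε) (h1 : ε ≤ 1) (hp0 : 0 < p) (hp1 : p < 1)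
    (ha : Real.log (1 - p) = -a) (hC : Real.log p = -(a + C)) (haC : C = (1 - ε) * a)
    {e : (k : ℕ) → (Fin k → Output) → Bool} (he : Admissible ε p e) (n : ℕ) :
    ∑ y, pathProb ε e n y * ((cell p n y).potential C - n * C) ^ 2 ≤ n * a ^ 2 := by
  induction n with
  | zero => simp [cell, Cell.potential]
  | succ n ih =>
    rw [sum_pathProb_succ]
    calc _ ≤ ∑ z : Fin n → Output,
          pathProb ε e n z * (((cell p n z).potential C - n * C) ^ 2 + a ^ 2) := by
          refine Finset.sum_le_sum fun z _ => ?_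
          rcases eq_or_ne (pathProb ε e n z) 0 with hz | hz
          · rw [hz, zero_mul, zero_mul]
          refine mul_le_mul_of_nonneg_left ?_ (pathProb_nonneg h0 h1 e n z)
          rw [cell_snoc, cell_snoc, Cell.potential_step_none,
            Cell.potential_step_some hp0 hp1 ha hC _ (cell_width_pos hp0 hp1 he n z hz) _
              (he n z hz)]
          generalize (cell p n z).potential C = φ
          push_cast
          split_ifs
          -- In a blocked cell the potential rises by exactly `C`, erased or not: no fluctuation.
          · nlinarith [sq_nonneg a]
          -- The cross term vanishes because the mean increment `(1 - ε) * a` is `C`; only the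
          -- variance is left.
          · have key : ε * (φ + 0 - (n + 1) * C) ^ 2 + (1 - ε) * (φ + a - (n + 1) * C) ^ 2
                = (φ - n * C) ^ 2 + ε * (1 - ε) * a ^ 2 := by
              rw [haC]; ring
            rw [key]
            have : ε * (1 - ε) ≤ 1 := by nlinarith
            nlinarith [sq_nonneg a]
      _ = ∑ z, pathProb ε e n z * ((cell p n z).potential C - n * C) ^ 2 + a ^ 2 := by
          simp only [mul_add, Finset.sum_add_distrib]
          rw [← Finset.sum_mul, sum_pathProb, one_mul]
      _ ≤ _ := by push_cast; linarith

/-- Chebyshev's inequality for the potential. -/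
lemma sum_pathProb_deviation_le {ε p a C δ : ℝ} (h0 : 0 ≤ ε) (h1 : ε ≤ 1) (hp0 : 0 < p)
    (hp1 : p < 1) (ha : Real.log (1 - p) = -a) (hC : Real.log p = -(a + C))
    (haC : C = (1 - ε) * a) (hδ : 0 < δ)
    {e : (k : ℕ) → (Fin k → Output) → Bool} (he : Admissible ε p e) {n : ℕ} (hn : 0 < n)
    (B : (Fin n → Output) → Prop) [DecidablePred B]
    (hB : ∀ y, pathProb ε e n y ≠ 0 → B y → n * δ ≤ |(cell p n y).potential C - n * C|) :
    ∑ y, (if B y then pathProb ε e n y else 0) ≤ a ^ 2 / δ ^ 2 / n := by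
  have hn' : (0 : ℝ) < n := Nat.cast_pos.mpr hn
  have h := sum_pathProb_mul_sq_le h0 h1 hp0 hp1 ha hC haC he n
  have h2 : (n * δ) ^ 2 * ∑ y, (if B y then pathProb ε e n y else 0) ≤ n * a ^ 2 := by
    refine le_trans ?_ h
    rw [Finset.mul_sum]
    refine Finset.sum_le_sum fun y _ => ?_
    have hP := pathProb_nonneg h0 h1 e n y
    split_ifs with hy
    · rcases eq_or_ne (pathProb ε e n y) 0 with hz | hz
      · simp [hz]
      rw [mul_comm]
      refine mul_le_mul_of_nonneg_left ?_ hP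
      rw [← sq_abs ((cell p n y).potential C - n * C)]
      exact pow_le_pow_left₀ (by positivity) (hB y hz hy) 2
    · rw [mul_zero]
      positivity
  rw [div_div, le_div_iff₀ (by positivity)]
  have h3 : n * ((∑ y, (if B y then pathProb ε e n y else 0)) * (δ ^ 2 * n)) ≤ n * a ^ 2 := by
    nlinarith
  exact le_of_mul_le_mul_left h3 hn'

/-- The parameter of the optimal subdivision. -/
lemma exists_splitting_parameter {ε : ℝ} (h1 : ε ≤ 1) :
    ∃ p : ℝ, 0 < p ∧ p ≤ 1 / 2 ∧ Real.log p = (2 - ε) * Real.log (1 - p) := by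
  have hc : ContinuousOn (fun p : ℝ => p - (1 - p) ^ (2 - ε)) (Set.Icc 0 1) :=
    (continuous_id.sub ((continuous_const.sub continuous_id).rpow_const
      fun _ => Or.inr (by linarith))).continuousOn
  have hm : (0 : ℝ) ∈ Set.Icc ((0 : ℝ) - (1 - 0) ^ (2 - ε)) (1 - (1 - 1) ^ (2 - ε)) := by
    rw [sub_zero, Real.one_rpow, sub_self, Real.zero_rpow (by linarith)]
    constructor <;> norm_num
  obtain ⟨p, ⟨hp0, hp1⟩, hp⟩ := intermediate_value_Icc zero_le_one hc hm
  have hp : p = (1 - p) ^ (2 - ε) := by simpa [sub_eq_zero] using hp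
  have hp0' : 0 < p := by
    refine lt_of_le_of_ne hp0 fun h => ?_
    rw [← h, sub_zero, Real.one_rpow] at hp
    exact zero_ne_one hp
  have hp1' : p < 1 := by
    refine lt_of_le_of_ne hp1 fun h => ?_
    rw [h, sub_self, Real.zero_rpow (by linarith)] at hp
    exact one_ne_zero hp
  refine ⟨p, hp0', ?_, ?_⟩
  -- Since `2 - ε ≥ 1`, the equation gives `p ≤ 1 - p`.
  · have : (1 - p) ^ (2 - ε) ≤ (1 - p) ^ (1 : ℝ) :=
      Real.rpow_le_rpow_of_exponent_ge (by linarith) (by linarith) (by linarith)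
    rw [← hp, Real.rpow_one] at this
    linarith
  · conv_lhs => rw [hp]
    exact Real.log_rpow (by linarith) _

/-! ### Non-causal codes -/

/-- The strategy of a non-causal code for the message `m`, as far as it influences the output. -/
def NoncausalCode.strategy {n M : ℕ} (c : NoncausalCode n M) (m : Fin M) (k : ℕ)
    (z : Fin k → Output) : Bool :=
  -- Only the choice for an unerased slot can be seen; past the block, `0` is always admissible.
  if h : k < n then c.enc ⟨k, h⟩ m z false else false

lemma NoncausalCode.sum_jointProb {n M : ℕ} (c : NoncausalCode n M) (ε : ℝ) (m : Fin M)
    (y : Fin n → Output) :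
    ∑ θ, c.jointProb ε m θ y = pathProb ε (c.strategy m) n y := by
  unfold NoncausalCode.jointProb pathProb
  rw [← Fintype.prod_sum (fun i (t : Bool) => erasureLaw ε t *
    (if y i = received (c.enc i m (past y i) t) t then (1 : ℝ) else 0))]
  refine Finset.prod_congr rfl fun i _ => ?_
  rw [Fintype.sum_bool]
  simp only [NoncausalCode.strategy, i.isLt, dif_pos, Fin.eta, erasureLaw, received,
    erasureChannel]
  rcases h : y i with _ | b <;> simp

lemma NoncausalCode.errorProb_eq {n M : ℕ} (c : NoncausalCode n M) (ε : ℝ) :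
    c.errorProb ε = (∑ m : Fin M, ∑ y : Fin n → Output,
      if c.dec y ≠ m then pathProb ε (c.strategy m) n y else 0) / (M : ℝ) := by
  unfold NoncausalCode.errorProb
  congr 1
  refine Finset.sum_congr rfl fun m _ => ?_
  rw [Finset.sum_comm]
  refine Finset.sum_congr rfl fun y _ => ?_
  split_ifs
  · exact c.sum_jointProb ε m y
  · simp

lemma Cell.eq_some_true_of_step_blocked {p : ℝ} {s : Cell} {b : Output}
    (h : (s.step p b).mode = .blocked) : b = some true := by
  obtain ⟨a, w, m⟩ := s
  rcases b with _ | _ | _ <;> cases m <;> simp_all [Cell.step]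

/-- A cell is blocked only right after a received `1`, which was really sent, so the constraint
forces `0`. -/
lemma NoncausalCode.admissible {n M : ℕ} (c : NoncausalCode n M) (ε p : ℝ) (m : Fin M) :
    Admissible ε p (c.strategy m) := by
  intro k z hz hb
  cases k with
  | zero => simp [cell] at hb
  | succ k =>
    by_cases hk : k + 1 < n
    · have hlast : z (Fin.last k) = some true := Cell.eq_some_true_of_step_blocked hb
      have hprev : c.strategy m k (Fin.init z) = true := by
        rw [← Fin.snoc_init_self z, pathProb_snoc, hlast] at hz
        by_contra hne
        exact right_ne_zero_of_mul hz (by simp [erasureChannel, hne])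
      have hk' : k < n := by omega
      -- The constraint speaks of full-length outputs, so `z` is padded with erasures.
      let y : Fin n → Output := fun i => if h : (i : ℕ) < k + 1 then z ⟨i, h⟩ else none
      have hy1 : past y ⟨k, hk'⟩ = Fin.init z := by
        funext j
        have hj : (j : ℕ) < k + 1 := j.isLt.trans (Nat.lt_succ_self k)
        simp only [past, y, Fin.val_castLE, hj, dif_pos]
        rfl
      have hy2 : past y ⟨k + 1, hk⟩ = z := by
        funext j
        have hj : (j : ℕ) < k + 1 := j.isLt
        simp only [past, y, Fin.val_castLE, hj, dif_pos, Fin.eta]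
      have hy3 : y ⟨k, hk'⟩ = some true := by
        simp only [y, Nat.lt_succ_self, dif_pos]
        exact hlast
      have h := c.rll m y ⟨k, hk'⟩ ⟨k + 1, hk⟩ false rfl
      rw [hy1, hy2, hy3] at h
      simp only [NoncausalCode.strategy, hk', hk, dif_pos] at hprev ⊢
      exact h hprev
    · simp [NoncausalCode.strategy, hk]

lemma numMessages_pos (R : ℝ) (n : ℕ) : 0 < numMessages R n :=
  Nat.ceil_pos.mpr (Real.rpow_pos_of_pos two_pos _)

/-- The probability of correct decoding, for any threshold `t` of the information density. -/
lemma NoncausalCode.one_sub_errorProb_le {n M : ℕ} (hM : 0 < M) (c : NoncausalCode n M)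
    {ε : ℝ} (h0 : 0 ≤ ε) (h1 : ε ≤ 1) {p : ℝ} (hp0 : 0 ≤ p) (hp1 : p ≤ 1) (t η : ℝ)
    (hη : ∀ m, ∑ y, (if (cell p n y).width < Real.exp (-t) then
      pathProb ε (c.strategy m) n y else 0) ≤ η) :
    1 - c.errorProb ε ≤ Real.exp t / M + η := by
  have hM' : (0 : ℝ) < M := Nat.cast_pos.mpr hM
  have hcorrect : 1 - c.errorProb ε = (∑ m : Fin M, ∑ y : Fin n → Output,
      if c.dec y = m then pathProb ε (c.strategy m) n y else 0) / (M : ℝ) := by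
    rw [c.errorProb_eq, eq_div_iff hM'.ne', sub_mul, div_mul_cancel₀ _ hM'.ne', one_mul,
      sub_eq_iff_eq_add, ← Finset.sum_add_distrib]
    have : ∀ m : Fin M, ((∑ y, if c.dec y = m then pathProb ε (c.strategy m) n y else 0) +
        ∑ y, if c.dec y ≠ m then pathProb ε (c.strategy m) n y else 0) = 1 := by
      intro m
      rw [← Finset.sum_add_distrib, ← sum_pathProb ε (c.strategy m) n]
      refine Finset.sum_congr rfl fun y _ => ?_
      by_cases h : c.dec y = m <;> simp [h]
    rw [Finset.sum_congr rfl fun m _ => this m]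
    simp
  -- Change of measure: unless the width is below `exp (-t)`, the true probability is at most `exp
  -- t` times the reference one.
  have hterm : ∀ (m : Fin M) (y : Fin n → Output),
      (if c.dec y = m then pathProb ε (c.strategy m) n y else 0) ≤
        (if c.dec y = m then Real.exp t * (patternProb ε y * (cell p n y).width) else 0) +
        (if (cell p n y).width < Real.exp (-t) then pathProb ε (c.strategy m) n y else 0) := by
    intro m y
    have hP := pathProb_nonneg h0 h1 (c.strategy m) n y
    have hQ := patternProb_nonneg h0 h1 y
    have hw := cell_width_nonneg hp0 hp1 n y
    have hle := pathProb_le_patternProb h0 h1 (c.strategy m) n y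
    have hpos : 0 ≤ Real.exp t * (patternProb ε y * (cell p n y).width) := by positivity
    split_ifs with ha hb
    · linarith
    · have h2 : 1 ≤ Real.exp t * (cell p n y).width := by
        rw [not_lt, Real.exp_neg, inv_le_iff_one_le_mul₀' (Real.exp_pos t)] at hb
        exact hb
      nlinarith
    · linarith
    · simp
  rw [hcorrect, div_le_iff₀ hM', add_mul, div_mul_cancel₀ _ hM'.ne']
  calc _ ≤ ∑ m : Fin M, ∑ y : Fin n → Output,
        ((if c.dec y = m then Real.exp t * (patternProb ε y * (cell p n y).width) else 0) +
        (if (cell p n y).width < Real.exp (-t) then pathProb ε (c.strategy m) n y else 0)) :=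
        Finset.sum_le_sum fun m _ => Finset.sum_le_sum fun y _ => hterm m y
    _ = Real.exp t + ∑ m : Fin M, ∑ y : Fin n → Output,
        (if (cell p n y).width < Real.exp (-t) then pathProb ε (c.strategy m) n y else 0) := by
        simp only [Finset.sum_add_distrib]
        -- Each output decodes to a single message, so the reference law is counted once.
        rw [Finset.sum_comm]
        simp only [Finset.sum_ite_eq, Finset.mem_univ, if_true]
        rw [← Finset.mul_sum, sum_patternProb_mul_width, mul_one]
    _ ≤ _ := by
        have := Finset.sum_le_sum (s := Finset.univ) fun (m : Fin M) _ => hη m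
        simp only [Finset.sum_const, Finset.card_univ, Fintype.card_fin, nsmul_eq_mul] at this
        linarith

lemma exp_mul_log_two_le_numMessages (R : ℝ) (n : ℕ) :
    Real.exp (n * (R * Real.log 2)) ≤ numMessages R n := by
  refine le_trans (le_of_eq ?_) (Nat.le_ceil _)
  rw [Real.rpow_def_of_pos two_pos]
  ring_nf

lemma log_numMessages_le {R : ℝ} (hR : 0 ≤ R) (n : ℕ) :
    Real.log (numMessages R n) ≤ n * (R * Real.log 2) + Real.log 2 := by
  have h1 : (1 : ℝ) ≤ 2 ^ ((n : ℝ) * R) := Real.one_le_rpow one_le_two (by positivity)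
  have h2 : (numMessages R n : ℝ) ≤ 2 * 2 ^ ((n : ℝ) * R) := by
    have := (Nat.ceil_lt_add_one (by linarith : (0 : ℝ) ≤ 2 ^ ((n : ℝ) * R))).le
    unfold numMessages
    linarith
  refine (Real.log_le_log (Nat.cast_pos.mpr (numMessages_pos R n)) h2).trans (le_of_eq ?_)
  rw [Real.log_mul two_ne_zero (by linarith), Real.log_rpow two_pos]
  ring

/-- The converse for non-causal codes. -/
lemma NoncausalAchievable.le {ε p a C R : ℝ} (h0 : 0 ≤ ε) (h1 : ε ≤ 1) (hp0 : 0 < p)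
    (hp1 : p < 1) (ha : Real.log (1 - p) = -a) (hC : Real.log p = -(a + C))
    (haC : C = (1 - ε) * a) (hC0 : 0 ≤ C) (hR : NoncausalAchievable ε R) :
    R * Real.log 2 ≤ C := by
  obtain ⟨-, c, hc⟩ := hR
  by_contra! hlt
  set δ := (R * Real.log 2 - C) / 2 with hδdef
  have hδ : 0 < δ := by linarith
  have hbound : ∀ᶠ n : ℕ in atTop,
      1 - (c n).errorProb ε ≤ Real.exp C * Real.exp (-(δ * n)) + a ^ 2 / δ ^ 2 / n := by
    filter_upwards [eventually_gt_atTop 0] with n hn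
    have hM := numMessages_pos R n
    have hM' : (0 : ℝ) < numMessages R n := Nat.cast_pos.mpr hM
    -- The extra `C` in the threshold covers the charge of a possibly blocked final cell.
    refine ((c n).one_sub_errorProb_le hM h0 h1 hp0.le hp1.le (n * (C + δ) + C)
      (a ^ 2 / δ ^ 2 / n) fun m => ?_).trans ?_
    · refine sum_pathProb_deviation_le h0 h1 hp0 hp1 ha hC haC hδ ((c n).admissible ε p m) hn _ ?_
      intro y hy hw
      have hwpos := cell_width_pos hp0 hp1 ((c n).admissible ε p m) n y hy
      have hlog := (Real.log_lt_iff_lt_exp hwpos).mpr hw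
      refine le_trans ?_ (le_abs_self _)
      unfold Cell.potential
      split_ifs <;> nlinarith
    · gcongr
      rw [div_le_iff₀ hM']
      refine le_trans (le_of_eq ?_) (mul_le_mul_of_nonneg_left
        (exp_mul_log_two_le_numMessages R n) (by positivity))
      rw [← Real.exp_add, ← Real.exp_add]
      congr 1
      rw [show R * Real.log 2 = C + 2 * δ by rw [hδdef]; ring]
      ring
  have hlim1 : Tendsto (fun n : ℕ => 1 - (c n).errorProb ε) atTop (𝓝 (1 - 0)) :=
    tendsto_const_nhds.sub hc
  have hexp : Tendsto (fun n : ℕ => Real.exp (-(δ * n))) atTop (𝓝 0) :=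
    Real.tendsto_exp_neg_atTop_nhds_zero.comp
      (tendsto_natCast_atTop_atTop.const_mul_atTop hδ)
  have hlim2 : Tendsto (fun n : ℕ => Real.exp C * Real.exp (-(δ * n)) + a ^ 2 / δ ^ 2 / n) atTop
      (𝓝 (Real.exp C * 0 + 0)) :=
    (hexp.const_mul _).add (tendsto_const_div_atTop_nhds_zero_nat _)
  have := le_of_tendsto_of_tendsto hlim1 hlim2 hbound
  norm_num at this

/-! ### Feedback codes -/

/-- A feedback code, as a non-causal code that ignores the erasure indicators. -/
def FeedbackCode.toNoncausal {n M : ℕ} (c : FeedbackCode n M) : NoncausalCode n M where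
  enc i m z _ := c.enc i m z
  dec := c.dec
  rll m y i j _ hij h := c.rll m y i j hij h

lemma FeedbackCode.outputProb_eq {n M : ℕ} (c : FeedbackCode n M) (ε : ℝ) (m : Fin M)
    (y : Fin n → Output) :
    c.outputProb ε m y = pathProb ε (c.toNoncausal.strategy m) n y := by
  unfold FeedbackCode.outputProb pathProb NoncausalCode.strategy
  simp only [Fin.is_lt, dif_pos, Fin.eta]
  rfl

lemma FeedbackCode.errorProb_toNoncausal {n M : ℕ} (c : FeedbackCode n M) (ε : ℝ) :
    c.toNoncausal.errorProb ε = c.errorProb ε := by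
  rw [NoncausalCode.errorProb_eq, FeedbackCode.errorProb]
  simp only [c.outputProb_eq]
  rfl

lemma FeedbackAchievable.noncausal {ε R : ℝ} (h : FeedbackAchievable ε R) :
    NoncausalAchievable ε R := by
  obtain ⟨hR, c, hc⟩ := h
  refine ⟨hR, fun n => (c n).toNoncausal, ?_⟩
  simpa only [FeedbackCode.errorProb_toNoncausal] using hc

/-- Shows that the capacity is at least `0`, which settles negative rates in the final comparison.
-/
lemma feedbackAchievable_zero (ε : ℝ) : FeedbackAchievable ε 0 := by
  have h1 : ∀ n, numMessages 0 n = 1 := fun n => by simp [numMessages]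
  refine ⟨le_rfl, fun n => ⟨fun _ _ _ => false, fun _ => ⟨0, numMessages_pos 0 n⟩,
    fun _ _ _ _ _ _ => rfl⟩, ?_⟩
  refine tendsto_const_nhds.congr fun n => ?_
  have : Subsingleton (Fin (numMessages 0 n)) := by rw [h1 n]; infer_instance
  have hd : ∀ i j : Fin (numMessages 0 n), ¬ (i ≠ j) := fun i j h => h (Subsingleton.elim i j)
  simp only [FeedbackCode.errorProb, hd, if_false, Finset.sum_const_zero, zero_div]

open Classical in
/-- The interval splitting code: the message `m` is represented by the point `m / M`, and the
decoder looks for a point in the final interval. -/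
def splittingCode {p : ℝ} (hp0 : 0 ≤ p) (hp : p ≤ 1 / 2) (n : ℕ) {M : ℕ} (hM : 0 < M) :
    FeedbackCode n M where
  enc i m z := decide ((m : ℝ) / M ∈ (cell p i z).ones p)
  dec y := if h : ∃ m : Fin M, (m : ℝ) / M ∈
      Set.Ico (cell p n y).lo ((cell p n y).lo + (cell p n y).width) then h.choose else ⟨0, hM⟩
  rll := by
    rintro m y ⟨i, hi⟩ ⟨j, hj⟩ hij h
    have hij : i + 1 = j := hij
    subst hij
    simp only [decide_eq_true_eq, decide_eq_false_iff_not] at h ⊢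
    have hs := Cell.notMem_ones_step hp _
      (cell_width_nonneg hp0 (by linarith) i (past y ⟨i, hi⟩)) (y ⟨i, hi⟩) _ h
    exact hs

lemma splittingCode_mem {ε p : ℝ} (hp0 : 0 ≤ p) (hp : p ≤ 1 / 2) (n : ℕ) {M : ℕ} (hM : 0 < M)
    (m : Fin M) (y : Fin n → Output)
    (hy : pathProb ε ((splittingCode hp0 hp n hM).toNoncausal.strategy m) n y ≠ 0) :
    (m : ℝ) / M ∈ Set.Ico (cell p n y).lo ((cell p n y).lo + (cell p n y).width) := by
  have hM' : (0 : ℝ) < M := Nat.cast_pos.mpr hM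
  -- The bound `k ≤ n` is needed because past the block the strategy no longer follows the splitting
  -- rule.
  refine pathProb_induction (motive := fun k z => k ≤ n → (m : ℝ) / M ∈
    Set.Ico (cell p k z).lo ((cell p k z).lo + (cell p k z).width)) ?_ ?_ ?_ n y hy le_rfl
  · intro _ _
    have : (m : ℝ) < M := Nat.cast_lt.mpr m.isLt
    simp only [cell, Set.mem_Ico, zero_add]
    exact ⟨by positivity, (div_lt_one hM').mpr this⟩
  · intro k z _ hz hk
    rw [cell_snoc]
    exact Cell.mem_step_none _ _ (hz (by omega))
  · intro k z _ hz hk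
    rw [cell_snoc]
    have hs : (splittingCode hp0 hp n hM).toNoncausal.strategy m k z =
        @decide ((m : ℝ) / M ∈ (cell p k z).ones p) (Classical.propDecidable _) := by
      simp only [NoncausalCode.strategy, dif_pos (show k < n by omega)]
      rfl
    rw [hs]
    exact Cell.mem_step _ _ (hz (by omega))

/-- Message points are `1 / M` apart, so a half-open interval of width at most `1 / M` contains only
one. -/
lemma splittingCode_dec {p : ℝ} (hp0 : 0 ≤ p) (hp : p ≤ 1 / 2) (n : ℕ) {M : ℕ} (hM : 0 < M)
    (m : Fin M) (y : Fin n → Output)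
    (hm : (m : ℝ) / M ∈ Set.Ico (cell p n y).lo ((cell p n y).lo + (cell p n y).width))
    (hw : (cell p n y).width ≤ 1 / M) : (splittingCode hp0 hp n hM).dec y = m := by
  have hM' : (0 : ℝ) < M := Nat.cast_pos.mpr hM
  have h : ∃ m : Fin M, (m : ℝ) / M ∈
      Set.Ico (cell p n y).lo ((cell p n y).lo + (cell p n y).width) := ⟨m, hm⟩
  have hdec : (splittingCode hp0 hp n hM).dec y = h.choose := dif_pos h
  rw [hdec]
  have hc := h.choose_spec
  generalize h.choose = m' at hc
  have h1 : ((m' : ℕ) : ℝ) < m + 1 := by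
    have : (m' : ℝ) / M < ((m : ℕ) + 1) / M := by
      rw [add_div]; linarith [hc.2, hm.1]
    exact (div_lt_div_iff_of_pos_right hM').mp this
  have h2 : ((m : ℕ) : ℝ) < m' + 1 := by
    have : (m : ℝ) / M < ((m' : ℕ) + 1) / M := by
      rw [add_div]; linarith [hm.2, hc.1]
    exact (div_lt_div_iff_of_pos_right hM').mp this
  have h1' : (m' : ℕ) < m + 1 := by exact_mod_cast h1
  have h2' : (m : ℕ) < m' + 1 := by exact_mod_cast h2
  exact Fin.ext (by omega)

lemma FeedbackCode.errorProb_nonneg {n M : ℕ} (c : FeedbackCode n M) {ε : ℝ} (h0 : 0 ≤ ε)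
    (h1 : ε ≤ 1) : 0 ≤ c.errorProb ε := by
  refine div_nonneg (Finset.sum_nonneg fun m _ => Finset.sum_nonneg fun y _ => ?_)
    (Nat.cast_nonneg _)
  rw [c.outputProb_eq]
  split_ifs
  · exact pathProb_nonneg h0 h1 _ _ _
  · exact le_rfl

/-- Interval splitting achieves all rates below the bound of the converse. -/
lemma feedbackAchievable_of_lt {ε p a C R : ℝ} (h0 : 0 ≤ ε) (h1 : ε ≤ 1) (hp0 : 0 < p)
    (hp : p ≤ 1 / 2) (ha : Real.log (1 - p) = -a) (hC : Real.log p = -(a + C))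
    (haC : C = (1 - ε) * a) (hC0 : 0 ≤ C) (hR0 : 0 ≤ R) (hR : R * Real.log 2 < C) :
    FeedbackAchievable ε R := by
  have hp1 : p < 1 := by linarith
  refine ⟨hR0, fun n => splittingCode hp0.le hp n (numMessages_pos R n), ?_⟩
  set δ := (C - R * Real.log 2) / 2 with hδdef
  have hδ : 0 < δ := by linarith
  refine tendsto_of_tendsto_of_tendsto_of_le_of_le' tendsto_const_nhds
    (tendsto_const_div_atTop_nhds_zero_nat (a ^ 2 / δ ^ 2))
    (Eventually.of_forall fun n => FeedbackCode.errorProb_nonneg _ h0 h1) ?_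
  -- Makes `n * δ` exceed `log 2`, the loss from rounding up the number of messages.
  have hlarge : ∀ᶠ n : ℕ in atTop, (C + Real.log 2) / δ ≤ n :=
    tendsto_natCast_atTop_atTop.eventually_ge_atTop _
  filter_upwards [hlarge, eventually_gt_atTop 0] with n hn hn0
  have hM := numMessages_pos R n
  have hM' : (0 : ℝ) < numMessages R n := Nat.cast_pos.mpr hM
  rw [div_le_iff₀ hδ] at hn
  have hlogM := log_numMessages_le hR0 n
  set c := splittingCode hp0.le hp n hM
  have hm : ∀ m, ∑ y, (if c.dec y ≠ m then c.outputProb ε m y else 0) ≤ a ^ 2 / δ ^ 2 / n := by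
    intro m
    simp only [c.outputProb_eq]
    have hadm := c.toNoncausal.admissible ε p m
    refine sum_pathProb_deviation_le h0 h1 hp0 hp1 ha hC haC hδ hadm hn0 _ ?_
    intro y hy hdec
    have hmem := splittingCode_mem hp0.le hp n hM m y hy
    have hwpos := cell_width_pos hp0 hp1 hadm n y hy
    have hw : 1 / (numMessages R n : ℝ) < (cell p n y).width := by
      by_contra! hle
      exact hdec (splittingCode_dec hp0.le hp n hM m y hmem hle)
    have hlog := Real.log_lt_log (by positivity) hw
    rw [one_div, Real.log_inv] at hlog
    have hRδ : R * Real.log 2 = C - 2 * δ := by rw [hδdef]; ring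
    rw [hRδ] at hlogM
    rw [abs_sub_comm]
    refine le_trans ?_ (le_abs_self _)
    unfold Cell.potential
    split_ifs <;> nlinarith
  rw [FeedbackCode.errorProb, div_le_iff₀ hM']
  refine (Finset.sum_le_sum fun m _ => hm m).trans (le_of_eq ?_)
  simp [mul_comm]

end RLLErasure

end

theorem theorem2 (ε : ℝ) (hε₀ : 0 ≤ ε) (hε₁ : ε ≤ 1) :
    RLLErasure.noncausalCapacity ε = RLLErasure.feedbackCapacity ε := by
  obtain ⟨p, hp0, hp, hlog⟩ := RLLErasure.exists_splitting_parameter hε₁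
  have hlog2 : 0 < Real.log 2 := Real.log_pos one_lt_two
  set a := -Real.log (1 - p) with ha'
  have ha : Real.log (1 - p) = -a := by rw [ha', neg_neg]
  have ha0 : 0 ≤ a := by
    have := Real.log_nonpos (by linarith : 0 ≤ 1 - p) (by linarith)
    linarith
  obtain ⟨C, haC⟩ : ∃ C, C = (1 - ε) * a := ⟨_, rfl⟩
  have hC0 : 0 ≤ C := haC ▸ mul_nonneg (by linarith) ha0
  have hC : Real.log p = -(a + C) := by rw [hlog, ha, haC]; ring
  apply le_antisymm
  -- The common value of the capacities, converted from nats to bits.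
  · trans ((C / Real.log 2 : ℝ) : EReal)
    · refine sSup_le ?_
      rintro _ ⟨R, hR, rfl⟩
      exact EReal.coe_le_coe_iff.mpr ((le_div_iff₀ hlog2).mpr
        (hR.le hε₀ hε₁ hp0 (by linarith) ha hC haC hC0))
    · refine EReal.ge_of_forall_gt_iff_ge.mp fun r hr => ?_
      have hr' : r < C / Real.log 2 := EReal.coe_lt_coe_iff.mp hr
      rcases lt_or_ge r 0 with hneg | hnonneg
      · exact (EReal.coe_le_coe_iff.mpr hneg.le).trans
          (le_sSup ⟨0, RLLErasure.feedbackAchievable_zero ε, rfl⟩)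
      · exact le_sSup ⟨r, RLLErasure.feedbackAchievable_of_lt hε₀ hε₁ hp0 hp ha hC haC hC0 hnonneg
          ((lt_div_iff₀ hlog2).mp hr'), rfl⟩
  · refine sSup_le_sSup ?_
    rintro _ ⟨R, hR, rfl⟩
    exact ⟨R, hR.noncausal, rfl⟩
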